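/- Let $I\subset\mathbb R$ be an open interval and let $\alpha:I\to\mathbb R^3$ be a smooth curve parametrized by arc length, with curvature $\kappa=\lVert\alpha''\rVert$ nowhere zero and not constant on $I$, unit normal $N=\alpha''/\kappa$, and torsion $\tau=\det(\alpha',\alpha'',\alpha''')/\lVert\alpha'\times\alpha''\rVert^2$. Suppose that for some real constants $c_1,c_2$ the curvature satisfies on $I$ $$5(\kappa')^2=c_2-\frac{2c_1}{\kappa}+\kappa^4,$$ and that the torsion satisfies on $I$ $$\kappa^{(4)}-15\kappa(\kappa')^2-10\kappa^2\kappa''+\kappa^5-\tau^2(\kappa''-2\kappa^3)=0.$$ Let $S$ be the ruled surface in $\mathbb R^3$ parametrized by $x(s,t)=\alpha(s)+tN(s)$, $s\in I$, at the points $(s,t)$ where $x$ is regular, with the Riemannian metric induced from $\mathbb R^3$ and the orientation of the coordinates $(s,t)$. Then the curve $t=0$, that is $\alpha(s)=x(s,0)$, consists of regular points and is a triharmonic curve in $S$: it is parametrized by arc length and its unit tangent $T$ satisfies $$\nabla_T^5T+R(\nabla_T^3T,T)T-R(\nabla_T^2T,\nabla_TT)T=0,$$ where $\nabla$ is the Levi-Civita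 connection of $S$ and $R(X,Y)Z=\nabla_X\nabla_YZ-\nabla_Y\nabla_XZ-\nabla_{[X,Y]}Z$. Moreover its geodesic curvature $\kappa_g$ in $S$, defined by $\nabla_TT=\kappa_g\,JT$ (so $\kappa_g=\langle\nabla_TT,JT\rangle$) with $J$ the counter-clockwise rotation by $\pi/2$ in the tangent planes of $S$, satisfies $\kappa_g=\kappa$ on $I$; in particular, $\kappa_g$ is not constant. -/

import Mathlib

open Set
open scoped ContDiff Matrix

noncomputable section

namespace TriharmonicCurves

/-! ### Riemannian geometry in a coordinate chart

A Riemannian metric on a coordinate domain in `Fin n → ℝ` is given by its matrix of coefficients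
`g u = (g_{ij}(u))`. -/

section Chart

variable {n : ℕ}

/-- The partial derivative of `f` in the `i`-th coordinate direction at `u`. -/
def partialDeriv {E : Type*} [NormedAddCommGroup E] [NormedSpace ℝ E]
    (i : Fin n) (f : (Fin n → ℝ) → E) (u : Fin n → ℝ) : E :=
  fderiv ℝ f u (Pi.single i 1)

/-- `g` is a smooth Riemannian metric on the open set `U`. -/
structure IsRiemannianMetricOn (g : (Fin n → ℝ) → Matrix (Fin n) (Fin n) ℝ)
    (U : Set (Fin n → ℝ)) : Prop where
  isOpen : IsOpen U
  smooth : ∀ i j, ContDiffOn ℝ ∞ (fun u => g u i j) U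
  posDef : ∀ u ∈ U, (g u).PosDef

/-- The inner product `g_u(v, w)`. -/
def metricInner (g : (Fin n → ℝ) → Matrix (Fin n) (Fin n) ℝ) (u v w : Fin n → ℝ) : ℝ :=
  ∑ i, ∑ j, g u i j * v i * w j

/-- The Christoffel symbol `Γ^k_{ij}` of the Levi-Civita connection of `g`. -/
def christoffel (g : (Fin n → ℝ) → Matrix (Fin n) (Fin n) ℝ) (u : Fin n → ℝ)
    (k i j : Fin n) : ℝ :=
  (1 / 2 : ℝ) * ∑ l, (g u)⁻¹ k l *
    (partialDeriv i (fun v => g v j l) u + partialDeriv j (fun v => g v i l) u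
      - partialDeriv l (fun v => g v i j) u)

/-- The component `R^l_{ijk}` of the Riemann curvature tensor, `R(∂_i, ∂_j) ∂_k = R^l_{ijk} ∂_l`,
with the convention `R(X, Y) Z = ∇_X ∇_Y Z - ∇_Y ∇_X Z - ∇_{[X, Y]} Z`. -/
def riemannComp (g : (Fin n → ℝ) → Matrix (Fin n) (Fin n) ℝ) (u : Fin n → ℝ)
    (l i j k : Fin n) : ℝ :=
  partialDeriv i (fun v => christoffel g v l j k) u
    - partialDeriv j (fun v => christoffel g v l i k) u
    + ∑ m, (christoffel g u m j k * christoffel g u l i m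
      - christoffel g u m i k * christoffel g u l j m)

/-- The Riemann curvature tensor `R(X, Y) Z` at the point `u`. -/
def riemann (g : (Fin n → ℝ) → Matrix (Fin n) (Fin n) ℝ) (u X Y Z : Fin n → ℝ) : Fin n → ℝ :=
  fun l => ∑ i, ∑ j, ∑ k, riemannComp g u l i j k * X i * Y j * Z k

/-- The covariant derivative `∇_T V` of a vector field `V` along the curve `γ`, where
`T = γ'`. -/
def covDerivAlong (g : (Fin n → ℝ) → Matrix (Fin n) (Fin n) ℝ) (γ : ℝ → Fin n → ℝ)
    (V : ℝ → Fin n → ℝ) : ℝ → Fin n → ℝ :=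
  fun s k => deriv (fun r => V r k) s
    + ∑ i, ∑ j, christoffel g (γ s) k i j * deriv (fun r => γ r i) s * V s j

/-- The velocity field `T = γ'`. -/
def velocity (γ : ℝ → Fin n → ℝ) : ℝ → Fin n → ℝ :=
  fun s i => deriv (fun r => γ r i) s

/-- `∇_T^m T` along `γ`. -/
def iterCovDeriv (g : (Fin n → ℝ) → Matrix (Fin n) (Fin n) ℝ) (γ : ℝ → Fin n → ℝ) (m : ℕ) :
    ℝ → Fin n → ℝ :=
  (covDerivAlong g γ)^[m] (velocity γ)

/-- `γ : I → (U, g)` is a triharmonic curve: it is a smooth curve in `U`, parametrized by arc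
length, with `∇_T⁵ T + R(∇_T³ T, T) T - R(∇_T² T, ∇_T T) T = 0`. -/
structure IsTriharmonicCurve (g : (Fin n → ℝ) → Matrix (Fin n) (Fin n) ℝ) (U : Set (Fin n → ℝ))
    (I : Set ℝ) (γ : ℝ → Fin n → ℝ) : Prop where
  mapsTo : MapsTo γ I U
  smooth : ContDiffOn ℝ ∞ γ I
  unit_speed : ∀ s ∈ I, metricInner g (γ s) (velocity γ s) (velocity γ s) = 1
  equation : ∀ s ∈ I,
    iterCovDeriv g γ 5 s
      + riemann g (γ s) (iterCovDeriv g γ 3 s) (velocity γ s) (velocity γ s)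
      - riemann g (γ s) (iterCovDeriv g γ 2 s) (iterCovDeriv g γ 1 s) (velocity γ s) = 0

end Chart

/-! ### Geodesic curvature in an oriented surface -/

/-- The rotation `J` by `π / 2` in the tangent plane at `u`, counter-clockwise for the metric `g`
and the orientation of the coordinates: `(v, J v)` is positively oriented,
`g(v, J v) = 0` and `g(J v, J v) = g(v, v)`. -/
def rotJ (g : (Fin 2 → ℝ) → Matrix (Fin 2) (Fin 2) ℝ) (u v : Fin 2 → ℝ) : Fin 2 → ℝ :=
  (√(g u).det)⁻¹ • ![-(g u 1 0 * v 0 + g u 1 1 * v 1), g u 0 0 * v 0 + g u 0 1 * v 1]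

/-- The geodesic curvature `κ_g = ⟨∇_T T, J T⟩` of an arc-length parametrized curve. -/
def geodesicCurvature (g : (Fin 2 → ℝ) → Matrix (Fin 2) (Fin 2) ℝ) (γ : ℝ → Fin 2 → ℝ)
    (s : ℝ) : ℝ :=
  metricInner g (γ s) (covDerivAlong g γ (velocity γ) s) (rotJ g (γ s) (velocity γ s))

/-! ### Parametrized surfaces and curves in Euclidean space -/

/-- The first fundamental form of a parametrized surface: the metric that it induces on its
coordinate domain. -/
def firstFundamentalForm (x : (Fin 2 → ℝ) → EuclideanSpace ℝ (Fin 3)) (u : Fin 2 → ℝ) :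
    Matrix (Fin 2) (Fin 2) ℝ :=
  Matrix.of fun i j => inner ℝ (partialDeriv i x u) (partialDeriv j x u)

/-- The curvature `‖α''‖` of an arc-length parametrized space curve. -/
def curvature (α : ℝ → EuclideanSpace ℝ (Fin 3)) (s : ℝ) : ℝ :=
  ‖iteratedDeriv 2 α s‖

/-- The torsion `det(α', α'', α''') / ‖α' × α''‖²` of a space curve. -/
def torsion (α : ℝ → EuclideanSpace ℝ (Fin 3)) (s : ℝ) : ℝ :=
  Matrix.det (Matrix.of ![(deriv α s).ofLp, (iteratedDeriv 2 α s).ofLp,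
      (iteratedDeriv 3 α s).ofLp])
    / ‖WithLp.toLp 2 (crossProduct (deriv α s).ofLp (iteratedDeriv 2 α s).ofLp)‖ ^ 2

/-- The unit normal `N = α'' / κ` of an arc-length parametrized space curve. -/
def unitNormal (α : ℝ → EuclideanSpace ℝ (Fin 3)) (s : ℝ) : EuclideanSpace ℝ (Fin 3) :=
  (curvature α s)⁻¹ • iteratedDeriv 2 α s

/-- The parametrization `x(s, t) = α(s) + t N(s)` of the ruled surface of the normal lines;
`u 0 = s` and `u 1 = t`. -/
def normalRuled (α : ℝ → EuclideanSpace ℝ (Fin 3)) (u : Fin 2 → ℝ) : EuclideanSpace ℝ (Fin 3) :=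
  α (u 0) + u 1 • unitNormal α (u 0)

/-- The set of the points `(s, t)`, `s ∈ I`, at which `x(s, t) = α(s) + t N(s)` is regular. -/
def regularDomain (α : ℝ → EuclideanSpace ℝ (Fin 3)) (I : Set ℝ) : Set (Fin 2 → ℝ) :=
  {u | u 0 ∈ I ∧ LinearIndependent ℝ fun i : Fin 2 => partialDeriv i (normalRuled α) u}

/-- The base curve `α` in the coordinates `(s, t)` of the ruled surface: the curve `t = 0`. -/
def baseCurve (s : ℝ) : Fin 2 → ℝ := ![s, 0]

end TriharmonicCurves

end

/-!
Put `T = α'` and let `N` be the unit normal. Since `⟨T, N⟩ = ⟨N, N'⟩ = 0` and `⟨T, N'⟩ = -κ`, the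
metric of the ruled surface `x(s, t) = α(s) + t N(s)` is `E ds² + dt²` with
`E = 1 - 2 t κ + t² ‖N'‖²` (`firstFundamentalForm_normalRuled`), and `‖N'‖² = κ² + τ²`
(`normalSpeedSq_eq`). Hence along `t = 0` the coordinate frame is orthonormal with `∇_T T = κ N`,
`∇_T N = -κ T` (`covDerivAlong_baseCurve`), so that `κ_g = κ`, and the Gauss curvature there is
`κ² - ‖N'‖² = -τ²` (`riemann_baseCurve`).

Iterating the two frame equations (`iterCovDeriv_baseCurve`) splits the triharmonic equation into a
tangential and a normal part. The normal part is the equation prescribed for the torsion. The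
tangential part is `-5 (κ κ''' + 2 κ' κ'' - 2 κ³ κ') = 0`, to which `R` does not contribute; it
follows from the first-order equation for `κ` by differentiating twice, with a separate argument at
the zeros of `κ'` (`third_order_of_first_order`).
-/

namespace TriharmonicCurves

open Filter Topology

/-! ### Derivatives of smooth functions on an open set -/

section Calculus

variable {E : Type*} [NormedAddCommGroup E] [NormedSpace ℝ E] {f : ℝ → E} {I : Set ℝ} {s : ℝ}

lemma contDiffOn_iteratedDeriv (hf : ContDiffOn ℝ ∞ f I) (hI : IsOpen I) (m : ℕ) :
    ContDiffOn ℝ ∞ (iteratedDeriv m f) I := by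
  induction m with
  | zero => simpa using hf
  | succ m ih =>
    rw [iteratedDeriv_succ]
    exact ih.deriv_of_isOpen hI (by simp)

lemma hasDerivAt_of_contDiffOn (hf : ContDiffOn ℝ ∞ f I) (hI : IsOpen I) (hs : s ∈ I) :
    HasDerivAt f (deriv f s) s :=
  ((hf.contDiffAt (hI.mem_nhds hs)).differentiableAt (by simp)).hasDerivAt

lemma hasDerivAt_iteratedDeriv (hf : ContDiffOn ℝ ∞ f I) (hI : IsOpen I) (hs : s ∈ I) (m : ℕ) :
    HasDerivAt (iteratedDeriv m f) (iteratedDeriv (m + 1) f s) s := by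
  rw [iteratedDeriv_succ]
  exact hasDerivAt_of_contDiffOn (contDiffOn_iteratedDeriv hf hI m) hI hs

lemma hasFDerivAt_comp_coord {n : ℕ} {f' : E} {u : Fin n → ℝ} {i : Fin n}
    (hf : HasDerivAt f f' (u i)) :
    HasFDerivAt (fun v : Fin n → ℝ => f (v i))
      ((ContinuousLinearMap.proj (R := ℝ) (φ := fun _ => ℝ) i).smulRight f') u := by
  refine (hf.hasFDerivAt.comp u (hasFDerivAt_apply (𝕜 := ℝ) i u)).congr_fderiv ?_
  ext v
  simp

lemma partialDeriv_congr {n : ℕ} {a b : (Fin n → ℝ) → E} {u : Fin n → ℝ} (h : a =ᶠ[𝓝 u] b)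
    (i : Fin n) : partialDeriv i a u = partialDeriv i b u := by
  rw [partialDeriv, partialDeriv, h.fderiv_eq]

lemma partialDeriv_const {n : ℕ} (c : E) (u : Fin n → ℝ) (i : Fin n) :
    partialDeriv i (fun _ => c) u = 0 := by
  simp [partialDeriv]

lemma contDiffOn_partialDeriv {n : ℕ} {a : (Fin n → ℝ) → E} {U : Set (Fin n → ℝ)}
    (ha : ContDiffOn ℝ ∞ a U) (hU : IsOpen U) (i : Fin n) :
    ContDiffOn ℝ ∞ (partialDeriv i a) U :=
  (ha.fderiv_of_isOpen hU (by simp)).clm_apply contDiffOn_const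

/-- Differentiation of a constant inner product `⟨f, g⟩`. -/
lemma inner_deriv_of_const {F : Type*} [NormedAddCommGroup F] [InnerProductSpace ℝ F]
    {f g : ℝ → F} {f' g' : F} {I : Set ℝ} (hI : IsOpen I) {c : ℝ}
    (h : ∀ r ∈ I, inner ℝ (f r) (g r) = c) {s : ℝ} (hs : s ∈ I)
    (hf : HasDerivAt f f' s) (hg : HasDerivAt g g' s) :
    inner ℝ (f s) g' + inner ℝ f' (g s) = 0 := by
  have h1 := hf.inner ℝ hg
  have h2 : (fun r => inner ℝ (f r) (g r)) =ᶠ[𝓝 s] fun _ => c := by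
    filter_upwards [hI.mem_nhds hs] with r hr using h r hr
  exact (h1.congr_of_eventuallyEq h2.symm).unique (hasDerivAt_const s c)

end Calculus

/-! ### The metric `(1 - 2 t k + t² m) ds² + dt²` along `t = 0` -/

section Metric

variable {g : (Fin 2 → ℝ) → Matrix (Fin 2) (Fin 2) ℝ} {u : Fin 2 → ℝ}

/-- The Christoffel symbols of a metric `E ds² + dt²`; the array on the right is indexed by the
upper index first. -/
lemma christoffel_diagonal {e : (Fin 2 → ℝ) → ℝ}
    (hg : g =ᶠ[𝓝 u] fun v => !![e v, 0; 0, 1]) (he : e u ≠ 0) (k i j : Fin 2) :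
    christoffel g u k i j =
      ![!![partialDeriv 0 e u / (2 * e u), partialDeriv 1 e u / (2 * e u);
          partialDeriv 1 e u / (2 * e u), 0],
        !![-partialDeriv 1 e u / 2, 0; 0, 0]] k i j := by
  have h00 : (fun v => g v 0 0) =ᶠ[𝓝 u] e := by
    filter_upwards [hg] with v hv; simp [hv]
  have h01 : (fun v => g v 0 1) =ᶠ[𝓝 u] fun _ => 0 := by
    filter_upwards [hg] with v hv; simp [hv]
  have h10 : (fun v => g v 1 0) =ᶠ[𝓝 u] fun _ => 0 := by
    filter_upwards [hg] with v hv; simp [hv]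
  have h11 : (fun v => g v 1 1) =ᶠ[𝓝 u] fun _ => 1 := by
    filter_upwards [hg] with v hv; simp [hv]
  have hinv : (g u)⁻¹ = !![(e u)⁻¹, 0; 0, 1] := by
    rw [hg.self_of_nhds]
    refine Matrix.inv_eq_right_inv ?_
    ext a b
    fin_cases a <;> fin_cases b <;> simp [he]
  have p00 := partialDeriv_congr h00
  have p01 := partialDeriv_congr h01
  have p10 := partialDeriv_congr h10
  have p11 := partialDeriv_congr h11
  simp only [partialDeriv_const] at p01 p10 p11
  fin_cases k <;> fin_cases i <;> fin_cases j <;>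
    simp [christoffel, hinv, p00, p01, p10, p11] <;> field_simp

/-- The coefficient `E = 1 - 2 t k(s) + t² m(s)` of a metric `E ds² + dt²`. -/
def lengthCoeff (k m : ℝ → ℝ) (u : Fin 2 → ℝ) : ℝ :=
  1 - 2 * u 1 * k (u 0) + u 1 ^ 2 * m (u 0)

lemma lengthCoeff_baseCurve (k m : ℝ → ℝ) (s : ℝ) : lengthCoeff k m (baseCurve s) = 1 := by
  simp [lengthCoeff, baseCurve]

variable {k m : ℝ → ℝ} {k' m' : ℝ}

lemma hasFDerivAt_lengthCoeff (hk : HasDerivAt k k' (u 0)) (hm : HasDerivAt m m' (u 0)) :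
    ∃ L : (Fin 2 → ℝ) →L[ℝ] ℝ, HasFDerivAt (lengthCoeff k m) L u ∧
      L (Pi.single 0 1) = -2 * u 1 * k' + u 1 ^ 2 * m' ∧
      L (Pi.single 1 1) = -2 * k (u 0) + 2 * u 1 * m (u 0) := by
  have ht := hasFDerivAt_apply (𝕜 := ℝ) (1 : Fin 2) u
  refine ⟨_, (((hasFDerivAt_const (1 : ℝ) u).sub ((ht.const_mul 2).mul
    (hasFDerivAt_comp_coord hk))).add ((ht.pow 2).mul (hasFDerivAt_comp_coord hm))), ?_, ?_⟩
  · simp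
  · simp; ring

lemma partialDeriv_zero_lengthCoeff (hk : HasDerivAt k k' (u 0)) (hm : HasDerivAt m m' (u 0)) :
    partialDeriv 0 (lengthCoeff k m) u = -2 * u 1 * k' + u 1 ^ 2 * m' := by
  obtain ⟨L, hL, h0, -⟩ := hasFDerivAt_lengthCoeff hk hm
  rw [partialDeriv, hL.fderiv, h0]

lemma partialDeriv_one_lengthCoeff (hk : HasDerivAt k k' (u 0)) (hm : HasDerivAt m m' (u 0)) :
    partialDeriv 1 (lengthCoeff k m) u = -2 * k (u 0) + 2 * u 1 * m (u 0) := by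
  obtain ⟨L, hL, -, h1⟩ := hasFDerivAt_lengthCoeff hk hm
  rw [partialDeriv, hL.fderiv, h1]

variable {I : Set ℝ} {s : ℝ}

lemma isOpen_strip (hI : IsOpen I) : IsOpen {u : Fin 2 → ℝ | u 0 ∈ I} :=
  hI.preimage (continuous_apply 0)

/-- At the points of the curve `t = 0` the only non-zero Christoffel symbols are
`Γ¹₀₀ = k` and `Γ⁰₀₁ = Γ⁰₁₀ = -k`. -/
lemma christoffel_baseCurve (hI : IsOpen I) (hk : ContDiffOn ℝ ∞ k I) (hm : ContDiffOn ℝ ∞ m I)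
    (hg : ∀ v, v 0 ∈ I → g v = !![lengthCoeff k m v, 0; 0, 1]) (hs : s ∈ I) (l i j : Fin 2) :
    christoffel g (baseCurve s) l i j = ![!![0, -k s; -k s, 0], !![k s, 0; 0, 0]] l i j := by
  have hmem : baseCurve s ∈ {u : Fin 2 → ℝ | u 0 ∈ I} := hs
  have hk1 := hasDerivAt_of_contDiffOn hk hI hs
  have hm1 := hasDerivAt_of_contDiffOn hm hI hs
  rw [christoffel_diagonal (Filter.eventuallyEq_of_mem ((isOpen_strip hI).mem_nhds hmem) hg)
    (by simp [lengthCoeff_baseCurve]), partialDeriv_zero_lengthCoeff (u := baseCurve s) hk1 hm1,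
    partialDeriv_one_lengthCoeff (u := baseCurve s) hk1 hm1, lengthCoeff_baseCurve]
  fin_cases l <;> fin_cases i <;> fin_cases j <;> simp [baseCurve, neg_div]

/-- Along the curve `t = 0` one has `R(∂₀, ∂₁) ∂₀ = (m - k²) ∂₁`: the Gauss curvature is
`k² - m`. -/
lemma riemannComp_baseCurve (hI : IsOpen I) (hk : ContDiffOn ℝ ∞ k I) (hm : ContDiffOn ℝ ∞ m I)
    (hg : ∀ v, v 0 ∈ I → g v = !![lengthCoeff k m v, 0; 0, 1]) (hs : s ∈ I) (l : Fin 2) :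
    riemannComp g (baseCurve s) l 0 1 0 = ![0, m s - k s ^ 2] l := by
  have hmem : {u : Fin 2 → ℝ | u 0 ∈ I} ∈ 𝓝 (baseCurve s) := (isOpen_strip hI).mem_nhds hs
  have hk1 := hasDerivAt_of_contDiffOn hk hI hs
  have hm1 := hasDerivAt_of_contDiffOn hm hI hs
  have hk2 := hasDerivAt_of_contDiffOn (hk.deriv_of_isOpen (m := ∞) hI (by simp)) hI hs
  have hm2 := hasDerivAt_of_contDiffOn (hm.deriv_of_isOpen (m := ∞) hI (by simp)) hI hs
  obtain ⟨L, hL, hL0, hL1⟩ := hasFDerivAt_lengthCoeff (u := baseCurve s) hk1 hm1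
  have hne : ∀ᶠ u in 𝓝 (baseCurve s), lengthCoeff k m u ≠ 0 :=
    hL.continuousAt.eventually_ne (by simp [lengthCoeff_baseCurve])
  -- The Christoffel symbols are differentiated below, so they are needed near the base point.
  have key : ∀ᶠ u in 𝓝 (baseCurve s), ∀ l i j, christoffel g u l i j =
      ![!![(-2 * u 1 * deriv k (u 0) + u 1 ^ 2 * deriv m (u 0)) * (2 * lengthCoeff k m u)⁻¹,
          (-2 * k (u 0) + 2 * u 1 * m (u 0)) * (2 * lengthCoeff k m u)⁻¹;
          (-2 * k (u 0) + 2 * u 1 * m (u 0)) * (2 * lengthCoeff k m u)⁻¹, 0],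
        !![-(-2 * k (u 0) + 2 * u 1 * m (u 0)) / 2, 0; 0, 0]] l i j := by
    filter_upwards [hmem, hne] with u hu hu' l i j
    have hk1 := hasDerivAt_of_contDiffOn hk hI hu
    have hm1 := hasDerivAt_of_contDiffOn hm hI hu
    rw [christoffel_diagonal (Filter.eventuallyEq_of_mem ((isOpen_strip hI).mem_nhds hu) hg) hu',
      partialDeriv_zero_lengthCoeff hk1 hm1, partialDeriv_one_lengthCoeff hk1 hm1]
    simp only [div_eq_mul_inv]
  have ht := hasFDerivAt_apply (𝕜 := ℝ) (1 : Fin 2) (baseCurve s)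
  have hk1' := hasFDerivAt_comp_coord (u := baseCurve s) (i := 0) hk1
  have hm1' := hasFDerivAt_comp_coord (u := baseCurve s) (i := 0) hm1
  have hk2' := hasFDerivAt_comp_coord (u := baseCurve s) (i := 0) hk2
  have hm2' := hasFDerivAt_comp_coord (u := baseCurve s) (i := 0) hm2
  have hinv : HasFDerivAt (fun u => (2 * lengthCoeff k m u)⁻¹) ((-(1 / 2 : ℝ)) • L)
      (baseCurve s) := by
    refine ((hasDerivAt_inv (x := 2 * lengthCoeff k m (baseCurve s))
      (by simp [lengthCoeff_baseCurve])).comp_hasFDerivAt (f := fun u => 2 * lengthCoeff k m u) _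
      (hL.const_mul 2)).congr_fderiv ?_
    ext v
    simp [lengthCoeff_baseCurve]
    ring
  have hEt := (hk1'.const_mul (-2)).fun_add ((ht.const_mul 2).fun_mul hm1')
  have h010 : partialDeriv 0 (fun v => christoffel g v 0 1 0) (baseCurve s) = -deriv k s := by
    rw [partialDeriv_congr (b := fun u => (-2 * k (u 0) + 2 * u 1 * m (u 0)) *
      (2 * lengthCoeff k m u)⁻¹) (by filter_upwards [key] with u hu; simp [hu]),
      partialDeriv, (hEt.fun_mul hinv).fderiv]
    simp [hL0, lengthCoeff_baseCurve]
    simp [baseCurve]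
  have h000 : partialDeriv 1 (fun v => christoffel g v 0 0 0) (baseCurve s) = -deriv k s := by
    rw [partialDeriv_congr (b := fun u => (-2 * u 1 * deriv k (u 0) + u 1 * u 1 * deriv m (u 0)) *
      (2 * lengthCoeff k m u)⁻¹) (by filter_upwards [key] with u hu; simp [hu, sq]),
      partialDeriv, ((((ht.const_mul (-2)).fun_mul hk2').fun_add
        ((ht.fun_mul ht).fun_mul hm2')).fun_mul hinv).fderiv]
    simp [hL1, lengthCoeff_baseCurve]
    simp [baseCurve]
    ring
  have h110 : partialDeriv 0 (fun v => christoffel g v 1 1 0) (baseCurve s) = 0 := by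
    rw [partialDeriv_congr (b := fun _ => (0 : ℝ)) (by filter_upwards [key] with u hu; simp [hu]),
      partialDeriv_const]
  have h100 : partialDeriv 1 (fun v => christoffel g v 1 0 0) (baseCurve s) = -m s := by
    rw [partialDeriv_congr (b := fun u => (-2 * k (u 0) + 2 * u 1 * m (u 0)) * (-1 / 2))
      (by filter_upwards [key] with u hu; simp [hu]; ring),
      partialDeriv, (hEt.mul_const (-1 / 2)).fderiv]
    simp
    simp [baseCurve]
    ring
  fin_cases l
  · simp [riemannComp, h010, h000, christoffel_baseCurve hI hk hm hg hs]
  · simp [riemannComp, h110, h100, christoffel_baseCurve hI hk hm hg hs]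
    ring

lemma riemannComp_self {n : ℕ} (g : (Fin n → ℝ) → Matrix (Fin n) (Fin n) ℝ) (u : Fin n → ℝ)
    (l i k : Fin n) : riemannComp g u l i i k = 0 := by
  simp [riemannComp]

lemma riemannComp_swap {n : ℕ} (g : (Fin n → ℝ) → Matrix (Fin n) (Fin n) ℝ) (u : Fin n → ℝ)
    (l i j k : Fin n) : riemannComp g u l j i k = -riemannComp g u l i j k := by
  simp only [riemannComp, Finset.sum_sub_distrib]
  ring

/-- On a surface `R(X, Y) Z` depends on `X, Y` only through `X⁰ Y¹ - X¹ Y⁰`; here `Z = ∂₀`. -/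
lemma riemann_baseCurve (hI : IsOpen I) (hk : ContDiffOn ℝ ∞ k I) (hm : ContDiffOn ℝ ∞ m I)
    (hg : ∀ v, v 0 ∈ I → g v = !![lengthCoeff k m v, 0; 0, 1]) (hs : s ∈ I) (X Y : Fin 2 → ℝ) :
    riemann g (baseCurve s) X Y ![1, 0] =
      ![0, (m s - k s ^ 2) * (X 0 * Y 1 - X 1 * Y 0)] := by
  have h := riemannComp_baseCurve hI hk hm hg hs
  funext l
  simp only [riemann, Fin.sum_univ_two, riemannComp_self,
    riemannComp_swap g (baseCurve s) l 0 1, h l]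
  fin_cases l <;> simp
  ring

lemma velocity_baseCurve : velocity baseCurve = fun _ => ![1, 0] := by
  funext s i
  fin_cases i <;> simp [velocity, baseCurve]

/-- Along the curve `t = 0` the frame `T = ∂₀`, `N = ∂₁` satisfies `∇_T T = k N` and
`∇_T N = -k T`. -/
lemma covDerivAlong_baseCurve (hI : IsOpen I) (hk : ContDiffOn ℝ ∞ k I)
    (hm : ContDiffOn ℝ ∞ m I)
    (hg : ∀ v, v 0 ∈ I → g v = !![lengthCoeff k m v, 0; 0, 1])
    {V : ℝ → Fin 2 → ℝ} {a b : ℝ → ℝ} {a' b' : ℝ} (hV : ∀ r ∈ I, V r = ![a r, b r]) (hs : s ∈ I)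
    (ha : HasDerivAt a a' s) (hb : HasDerivAt b b' s) :
    covDerivAlong g baseCurve V s = ![a' - k s * b s, b' + k s * a s] := by
  have h0 : (fun r => V r 0) =ᶠ[𝓝 s] a := by
    filter_upwards [hI.mem_nhds hs] with r hr; simp [hV r hr]
  have h1 : (fun r => V r 1) =ᶠ[𝓝 s] b := by
    filter_upwards [hI.mem_nhds hs] with r hr; simp [hV r hr]
  have hv := congrFun velocity_baseCurve s
  have hv0 : deriv (fun r => baseCurve r 0) s = 1 := by simpa [velocity] using congrFun hv 0
  have hv1 : deriv (fun r => baseCurve r 1) s = 0 := by simpa [velocity] using congrFun hv 1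
  funext l
  fin_cases l
  · simp [covDerivAlong, christoffel_baseCurve hI hk hm hg hs, hv0, hv1, hV s hs,
      h0.deriv_eq, ha.deriv]
    ring
  · simp [covDerivAlong, christoffel_baseCurve hI hk hm hg hs, hv0, hv1, hV s hs,
      h1.deriv_eq, hb.deriv]

end Metric
/-! ### The ruled surface of the normal lines of a space curve -/

section Curve

variable {α : ℝ → EuclideanSpace ℝ (Fin 3)} {I : Set ℝ} {s : ℝ}

/-- The squared speed `‖N'‖²` of the unit normal. -/
noncomputable def normalSpeedSq (α : ℝ → EuclideanSpace ℝ (Fin 3)) (s : ℝ) : ℝ :=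
  ‖deriv (unitNormal α) s‖ ^ 2

lemma contDiffOn_curvature (hI : IsOpen I) (hα : ContDiffOn ℝ ∞ α I)
    (hne : ∀ s ∈ I, curvature α s ≠ 0) : ContDiffOn ℝ ∞ (curvature α) I :=
  (contDiffOn_iteratedDeriv hα hI 2).norm ℝ fun s hs => norm_ne_zero_iff.1 (hne s hs)

lemma contDiffOn_unitNormal (hI : IsOpen I) (hα : ContDiffOn ℝ ∞ α I)
    (hne : ∀ s ∈ I, curvature α s ≠ 0) : ContDiffOn ℝ ∞ (unitNormal α) I :=
  ((contDiffOn_curvature hI hα hne).inv hne).smul (contDiffOn_iteratedDeriv hα hI 2)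

lemma contDiffOn_normalSpeedSq (hI : IsOpen I) (hα : ContDiffOn ℝ ∞ α I)
    (hne : ∀ s ∈ I, curvature α s ≠ 0) : ContDiffOn ℝ ∞ (normalSpeedSq α) I :=
  ((contDiffOn_unitNormal hI hα hne).deriv_of_isOpen (m := ∞) hI (by simp)).norm_sq ℝ

lemma iteratedDeriv_two_eq_smul (hne : curvature α s ≠ 0) :
    iteratedDeriv 2 α s = curvature α s • unitNormal α s := by
  rw [unitNormal, smul_inv_smul₀ hne]

lemma norm_unitNormal (hne : curvature α s ≠ 0) : ‖unitNormal α s‖ = 1 := by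
  rw [unitNormal, norm_smul, norm_inv,
    Real.norm_of_nonneg (show 0 ≤ curvature α s from norm_nonneg _)]
  exact inv_mul_cancel₀ hne

lemma inner_tangent_unitNormal (hI : IsOpen I) (hα : ContDiffOn ℝ ∞ α I)
    (hunit : ∀ s ∈ I, ‖deriv α s‖ = 1) (hs : s ∈ I) :
    inner ℝ (deriv α s) (unitNormal α s) = 0 := by
  have hT : HasDerivAt (deriv α) (iteratedDeriv 2 α s) s := by
    simpa using hasDerivAt_iteratedDeriv hα hI hs 1
  have h := inner_deriv_of_const hI (f := deriv α) (g := deriv α) (c := 1)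
    (fun r hr => by simp [hunit r hr]) hs hT hT
  rw [real_inner_comm (deriv α s)] at h
  rw [unitNormal, inner_smul_right, add_self_eq_zero.1 h, mul_zero]

lemma inner_unitNormal_deriv (hI : IsOpen I) (hα : ContDiffOn ℝ ∞ α I)
    (hne : ∀ s ∈ I, curvature α s ≠ 0) (hs : s ∈ I) :
    inner ℝ (unitNormal α s) (deriv (unitNormal α) s) = 0 := by
  have hN := hasDerivAt_of_contDiffOn (contDiffOn_unitNormal hI hα hne) hI hs
  have h := inner_deriv_of_const hI (c := 1)
    (fun r hr => by simp [norm_unitNormal (hne r hr)]) hs hN hN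
  rw [real_inner_comm (unitNormal α s) (deriv (unitNormal α) s)] at h
  linarith

lemma inner_tangent_deriv_unitNormal (hI : IsOpen I) (hα : ContDiffOn ℝ ∞ α I)
    (hunit : ∀ s ∈ I, ‖deriv α s‖ = 1) (hne : ∀ s ∈ I, curvature α s ≠ 0) (hs : s ∈ I) :
    inner ℝ (deriv α s) (deriv (unitNormal α) s) = -curvature α s := by
  have hN := hasDerivAt_of_contDiffOn (contDiffOn_unitNormal hI hα hne) hI hs
  have hT : HasDerivAt (deriv α) (iteratedDeriv 2 α s) s := by
    simpa using hasDerivAt_iteratedDeriv hα hI hs 1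
  have h := inner_deriv_of_const hI
    (fun r hr => inner_tangent_unitNormal hI hα hunit hr) hs hT hN
  rw [iteratedDeriv_two_eq_smul (hne s hs), inner_smul_left, real_inner_self_eq_norm_sq,
    norm_unitNormal (hne s hs)] at h
  simp at h
  linarith

/-- The squared triple product is the Gram determinant, since `M Mᵀ` is the Gram matrix of the rows
of `M`. -/
lemma det_sq_eq_det_gram (a b c : EuclideanSpace ℝ (Fin 3)) :
    Matrix.det (Matrix.of ![a.ofLp, b.ofLp, c.ofLp]) ^ 2
      = (Matrix.gram ℝ ![a, b, c]).det := by
  rw [sq]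
  nth_rewrite 2 [← Matrix.det_transpose]
  rw [← Matrix.det_mul]
  congr 1
  ext i j
  fin_cases i <;> fin_cases j <;>
    simp [Matrix.mul_apply, PiLp.inner_apply, Fin.sum_univ_three, mul_comm,
      -inner_self_eq_norm_sq_to_K]

lemma norm_cross_sq (a b : EuclideanSpace ℝ (Fin 3)) :
    ‖(WithLp.toLp 2 (crossProduct a.ofLp b.ofLp) : EuclideanSpace ℝ (Fin 3))‖ ^ 2 =
      ‖a‖ ^ 2 * ‖b‖ ^ 2 - inner ℝ a b ^ 2 := by
  simp only [EuclideanSpace.norm_sq_eq, PiLp.inner_apply, Fin.sum_univ_three, cross_apply]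
  simp
  ring

/-- The Frenet equation for `N'` in the form `‖N'‖² = κ² + τ²`; squaring the triple product that
defines `τ` turns it into the Gram determinant of `α', α'', α'''`. -/
lemma normalSpeedSq_eq (hI : IsOpen I) (hα : ContDiffOn ℝ ∞ α I)
    (hunit : ∀ s ∈ I, ‖deriv α s‖ = 1) (hne : ∀ s ∈ I, curvature α s ≠ 0) (hs : s ∈ I) :
    normalSpeedSq α s = curvature α s ^ 2 + torsion α s ^ 2 := by
  have hN := hasDerivAt_of_contDiffOn (contDiffOn_unitNormal hI hα hne) hI hs
  have hκ := hasDerivAt_of_contDiffOn (contDiffOn_curvature hI hα hne) hI hs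
  have hA := hasDerivAt_iteratedDeriv hα hI hs 2
  have hA' : iteratedDeriv 2 α =ᶠ[𝓝 s] fun r => curvature α r • unitNormal α r := by
    filter_upwards [hI.mem_nhds hs] with r hr using iteratedDeriv_two_eq_smul (hne r hr)
  have hC := hA.unique ((hκ.smul hN).congr_of_eventuallyEq hA')
  have hTN := inner_tangent_unitNormal hI hα hunit hs
  have hNN' := inner_unitNormal_deriv hI hα hne hs
  have hTN' := inner_tangent_deriv_unitNormal hI hα hunit hne hs
  have hn := norm_unitNormal (hne s hs)
  have hκ0 := hne s hs
  have hm : inner ℝ (deriv (unitNormal α) s) (deriv (unitNormal α) s) = normalSpeedSq α s :=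
    real_inner_self_eq_norm_sq _
  rw [torsion, div_pow, det_sq_eq_det_gram, norm_cross_sq, hC, iteratedDeriv_two_eq_smul hκ0]
  have hNT := (real_inner_comm (deriv α s) (unitNormal α s)).trans hTN
  have hN'N := (real_inner_comm (unitNormal α s) (deriv (unitNormal α) s)).trans hNN'
  have hN'T := (real_inner_comm (deriv α s) (deriv (unitNormal α) s)).trans hTN'
  have hTT : inner ℝ (deriv α s) (deriv α s) = 1 := by simp [hunit s hs]
  have hNN : inner ℝ (unitNormal α s) (unitNormal α s) = 1 := by simp [hn]
  simp [Matrix.det_fin_three, inner_smul_left, inner_smul_right, inner_add_left, inner_add_right,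
    hunit s hs, norm_smul, hn, hTT, hNN, hTN, hNN', hTN', hNT, hN'N, hN'T, hm,
    -inner_self_eq_norm_sq_to_K]
  field_simp
  ring

lemma contDiffOn_normalRuled (hI : IsOpen I) (hα : ContDiffOn ℝ ∞ α I)
    (hne : ∀ s ∈ I, curvature α s ≠ 0) :
    ContDiffOn ℝ ∞ (normalRuled α) {u | u 0 ∈ I} := by
  have h0 : ContDiffOn ℝ ∞ (fun u : Fin 2 → ℝ => u 0) {u | u 0 ∈ I} :=
    (contDiff_apply ℝ ℝ 0).contDiffOn
  have h1 : ContDiffOn ℝ ∞ (fun u : Fin 2 → ℝ => u 1) {u | u 0 ∈ I} :=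
    (contDiff_apply ℝ ℝ 1).contDiffOn
  exact (hα.comp h0 fun u hu => hu).add
    (h1.smul ((contDiffOn_unitNormal hI hα hne).comp h0 fun u hu => hu))

lemma partialDeriv_normalRuled (hI : IsOpen I) (hα : ContDiffOn ℝ ∞ α I)
    (hne : ∀ s ∈ I, curvature α s ≠ 0) {u : Fin 2 → ℝ} (hu : u 0 ∈ I) :
    partialDeriv 0 (normalRuled α) u = deriv α (u 0) + u 1 • deriv (unitNormal α) (u 0) ∧
      partialDeriv 1 (normalRuled α) u = unitNormal α (u 0) := by
  have h : HasFDerivAt (normalRuled α) _ u :=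
    (hasFDerivAt_comp_coord (hasDerivAt_of_contDiffOn hα hI hu)).fun_add
      ((hasFDerivAt_apply (𝕜 := ℝ) (1 : Fin 2) u).fun_smul
        (hasFDerivAt_comp_coord
          (hasDerivAt_of_contDiffOn (contDiffOn_unitNormal hI hα hne) hI hu)))
  simp [partialDeriv, h.fderiv]

lemma firstFundamentalForm_normalRuled (hI : IsOpen I) (hα : ContDiffOn ℝ ∞ α I)
    (hunit : ∀ s ∈ I, ‖deriv α s‖ = 1) (hne : ∀ s ∈ I, curvature α s ≠ 0)
    (u : Fin 2 → ℝ) (hu : u 0 ∈ I) :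
    firstFundamentalForm (normalRuled α) u =
      !![lengthCoeff (curvature α) (normalSpeedSq α) u, 0; 0, 1] := by
  obtain ⟨h0, h1⟩ := partialDeriv_normalRuled hI hα hne hu
  have hTN := inner_tangent_unitNormal hI hα hunit hu
  have hNN' := inner_unitNormal_deriv hI hα hne hu
  have hTN' := inner_tangent_deriv_unitNormal hI hα hunit hne hu
  have hNT := (real_inner_comm (deriv α (u 0)) (unitNormal α (u 0))).trans hTN
  have hN'N := (real_inner_comm (unitNormal α (u 0)) _).trans hNN'
  have hN'T := (real_inner_comm (deriv α (u 0)) _).trans hTN'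
  have hTT : inner ℝ (deriv α (u 0)) (deriv α (u 0)) = 1 := by simp [hunit _ hu]
  have hNN : inner ℝ (unitNormal α (u 0)) (unitNormal α (u 0)) = 1 := by
    simp [norm_unitNormal (hne _ hu)]
  have hm : inner ℝ (deriv (unitNormal α) (u 0)) (deriv (unitNormal α) (u 0)) =
    normalSpeedSq α (u 0) := real_inner_self_eq_norm_sq _
  ext i j
  fin_cases i <;> fin_cases j <;>
    simp [firstFundamentalForm, h0, h1, inner_smul_left, inner_smul_right, inner_add_left,
      inner_add_right, hTT, hNN, hm, hTN, hNN', hTN', hNT, hN'N, hN'T,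
      lengthCoeff, -inner_self_eq_norm_sq_to_K]
  ring

lemma det_firstFundamentalForm_ne_zero_iff (x : (Fin 2 → ℝ) → EuclideanSpace ℝ (Fin 3))
    (u : Fin 2 → ℝ) :
    (firstFundamentalForm x u).det ≠ 0 ↔ LinearIndependent ℝ fun i => partialDeriv i x u :=
  Matrix.det_gram_ne_zero_iff_linearIndependent

lemma contDiffOn_firstFundamentalForm {x : (Fin 2 → ℝ) → EuclideanSpace ℝ (Fin 3)}
    {U : Set (Fin 2 → ℝ)} (hx : ContDiffOn ℝ ∞ x U) (hU : IsOpen U) (i j : Fin 2) :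
    ContDiffOn ℝ ∞ (fun u => firstFundamentalForm x u i j) U :=
  (contDiffOn_partialDeriv hx hU i).inner ℝ (contDiffOn_partialDeriv hx hU j)

lemma isRiemannianMetricOn_normalRuled (hI : IsOpen I) (hα : ContDiffOn ℝ ∞ α I)
    (hne : ∀ s ∈ I, curvature α s ≠ 0) :
    IsRiemannianMetricOn (firstFundamentalForm (normalRuled α)) (regularDomain α I) := by
  have hS := isOpen_strip hI
  have hg := contDiffOn_firstFundamentalForm (contDiffOn_normalRuled hI hα hne) hS
  refine ⟨?_, fun i j => (hg i j).mono fun u hu => hu.1,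
    fun u hu => Matrix.posDef_gram_of_linearIndependent hu.2⟩
  have hdet : ContinuousOn (fun u => (firstFundamentalForm (normalRuled α) u).det)
      {u | u 0 ∈ I} := by
    simp only [Matrix.det_fin_two]
    exact ((hg 0 0).continuousOn.mul (hg 1 1).continuousOn).sub
      ((hg 0 1).continuousOn.mul (hg 1 0).continuousOn)
  convert hdet.isOpen_inter_preimage hS (isOpen_compl_singleton (x := (0 : ℝ))) using 1
  ext u
  simp [regularDomain, ← det_firstFundamentalForm_ne_zero_iff]

end Curve

/-! ### The two components of the triharmonic equation -/

section Equation

variable {I : Set ℝ} {k : ℝ → ℝ} {s : ℝ}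

/-- The third-order consequence `k k''' + 2 k' k'' = 2 k³ k'` of the first-order equation for `k`.
Multiplying by `k` and differentiating gives `k' F = 0` with `F = 5 k'² + 10 k k'' - 5 k⁴ - c₂`, and
the claim is `F' = 0` up to the factor `10`. It also holds where `k'` vanishes, because on an open set with `F' ≠ 0` the factor `k'`
would vanish identically, and with it `F'`. -/
lemma third_order_of_first_order (hI : IsOpen I) (hk : ContDiffOn ℝ ∞ k I)
    (hne : ∀ s ∈ I, k s ≠ 0) {c₁ c₂ : ℝ}
    (h : ∀ s ∈ I, 5 * (deriv k s) ^ 2 = c₂ - 2 * c₁ * (1 / k s) + k s ^ 4) (hs : s ∈ I) :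
    k s * iteratedDeriv 3 k s + 2 * deriv k s * iteratedDeriv 2 k s
      - 2 * k s ^ 3 * deriv k s = 0 := by
  have d0 : ∀ r ∈ I, HasDerivAt k (deriv k r) r := fun r hr => hasDerivAt_of_contDiffOn hk hI hr
  have d1 : ∀ r ∈ I, HasDerivAt (deriv k) (iteratedDeriv 2 k r) r := fun r hr => by
    simpa using hasDerivAt_iteratedDeriv hk hI hr 1
  have d2 : ∀ r ∈ I, HasDerivAt (iteratedDeriv 2 k) (iteratedDeriv 3 k r) r := fun r hr =>
    hasDerivAt_iteratedDeriv hk hI hr 2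
  set G : ℝ → ℝ := fun r => k r * iteratedDeriv 3 k r + 2 * deriv k r * iteratedDeriv 2 k r
      - 2 * k r ^ 3 * deriv k r with hG
  set F : ℝ → ℝ := fun r => 5 * deriv k r ^ 2 + 10 * (k r * iteratedDeriv 2 k r)
      - 5 * k r ^ 4 - c₂ with hF
  have hFG : ∀ r ∈ I, HasDerivAt F (10 * G r) r := fun r hr => by
    refine ((((((d1 r hr).pow 2).const_mul 5).add (((d0 r hr).mul (d2 r hr)).const_mul 10)).sub
      (((d0 r hr).pow 4).const_mul 5)).sub_const c₂).congr_deriv ?_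
    simp [hG]
    ring
  have hkF : ∀ r ∈ I, deriv k r * F r = 0 := fun r hr => by
    -- Multiplying by `k` clears the denominator: `5 k k'² - c₂ k - k⁵` is constant.
    have hP : HasDerivAt (fun q => 5 * (k q * deriv k q ^ 2) - c₂ * k q - k q ^ 5) _ r :=
      ((((d0 r hr).mul ((d1 r hr).pow 2)).const_mul 5).sub ((d0 r hr).const_mul c₂)).sub
        ((d0 r hr).pow 5)
    have hc : (fun q => 5 * (k q * deriv k q ^ 2) - c₂ * k q - k q ^ 5) =ᶠ[𝓝 r]
        fun _ => -2 * c₁ := by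
      filter_upwards [hI.mem_nhds hr] with q hq
      have h1 := h q hq
      have h2 := hne q hq
      field_simp at h1
      linear_combination h1
    have h0 := (hP.congr_of_eventuallyEq hc.symm).unique (hasDerivAt_const r (-2 * c₁))
    simp at h0
    simp only [hF]
    linear_combination h0
  by_contra hGs
  have hGc : ContinuousAt G s := by
    have c0 := (d0 s hs).continuousAt
    have c1 := (d1 s hs).continuousAt
    have c2 := (d2 s hs).continuousAt
    have c3 := (hasDerivAt_iteratedDeriv hk hI hs 3).continuousAt
    exact ((c0.mul c3).add ((c1.const_mul 2).mul c2)).sub (((c0.pow 3).const_mul 2).mul c1)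
  have hk0 : deriv k =ᶠ[𝓝 s] fun _ => 0 := by
    filter_upwards [hI.mem_nhds hs, hGc.eventually_ne hGs] with r hr hGr
    by_contra hkr
    have hF0 : F =ᶠ[𝓝 r] fun _ => 0 := by
      filter_upwards [hI.mem_nhds hr, (d1 r hr).continuousAt.eventually_ne hkr] with q hq hkq
      exact (mul_eq_zero.1 (hkF q hq)).resolve_left hkq
    have := ((hFG r hr).congr_of_eventuallyEq hF0.symm).unique (hasDerivAt_const r 0)
    exact hGr (by linarith)
  have h1 : deriv k s = 0 := hk0.self_of_nhds
  have h3 : iteratedDeriv 3 k s = 0 := by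
    have : iteratedDeriv 2 k =ᶠ[𝓝 s] fun _ => 0 := by
      have := hk0.deriv
      filter_upwards [this] with r hr
      simpa [iteratedDeriv_succ] using hr
    rw [iteratedDeriv_succ, this.deriv_eq, deriv_const]
  exact hGs (by simp [h1, h3])

variable {g : (Fin 2 → ℝ) → Matrix (Fin 2) (Fin 2) ℝ} {m : ℝ → ℝ}

/-- `∇_Tⁿ T` in the frame `T = ∂₀`, `N = ∂₁` along the curve `t = 0`, for `n = 1, 2, 3, 5`. -/
lemma iterCovDeriv_baseCurve (hI : IsOpen I) (hk : ContDiffOn ℝ ∞ k I)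
    (hm : ContDiffOn ℝ ∞ m I)
    (hg : ∀ v, v 0 ∈ I → g v = !![lengthCoeff k m v, 0; 0, 1]) (hs : s ∈ I) :
    iterCovDeriv g baseCurve 1 s = ![0, k s] ∧
    iterCovDeriv g baseCurve 2 s = ![-k s ^ 2, deriv k s] ∧
    iterCovDeriv g baseCurve 3 s =
      ![-3 * k s * deriv k s, iteratedDeriv 2 k s - k s ^ 3] ∧
    iterCovDeriv g baseCurve 5 s =
      ![-5 * (k s * iteratedDeriv 3 k s + 2 * deriv k s * iteratedDeriv 2 k s
          - 2 * k s ^ 3 * deriv k s),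
        iteratedDeriv 4 k s - 15 * k s * deriv k s ^ 2 - 10 * k s ^ 2 * iteratedDeriv 2 k s
          + k s ^ 5] := by
  have d0 : ∀ r ∈ I, HasDerivAt k (deriv k r) r := fun r hr => hasDerivAt_of_contDiffOn hk hI hr
  have d1 : ∀ r ∈ I, HasDerivAt (deriv k) (iteratedDeriv 2 k r) r := fun r hr => by
    simpa using hasDerivAt_iteratedDeriv hk hI hr 1
  have d2 : ∀ r ∈ I, HasDerivAt (iteratedDeriv 2 k) (iteratedDeriv 3 k r) r := fun r hr =>
    hasDerivAt_iteratedDeriv hk hI hr 2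
  have d3 : ∀ r ∈ I, HasDerivAt (iteratedDeriv 3 k) (iteratedDeriv 4 k r) r := fun r hr =>
    hasDerivAt_iteratedDeriv hk hI hr 3
  have step : ∀ (n : ℕ) (a b a' b' : ℝ → ℝ),
      (∀ r ∈ I, iterCovDeriv g baseCurve n r = ![a r, b r]) →
      (∀ r ∈ I, HasDerivAt a (a' r) r) → (∀ r ∈ I, HasDerivAt b (b' r) r) →
      ∀ r ∈ I, iterCovDeriv g baseCurve (n + 1) r = ![a' r - k r * b r, b' r + k r * a r] := by
    intro n a b a' b' hV ha hb r hr
    rw [iterCovDeriv, Function.iterate_succ_apply']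
    exact covDerivAlong_baseCurve hI hk hm hg hV hr (ha r hr) (hb r hr)
  have e0 : ∀ r ∈ I, iterCovDeriv g baseCurve 0 r = ![1, 0] := fun r _ => by
    simp [iterCovDeriv, velocity_baseCurve]
  have e1 : ∀ r ∈ I, iterCovDeriv g baseCurve 1 r = ![0, k r] := fun r hr => by
    simpa using step 0 (fun _ => 1) (fun _ => 0) (fun _ => 0) (fun _ => 0) e0
      (fun r _ => hasDerivAt_const r 1) (fun r _ => hasDerivAt_const r 0) r hr
  have e2 : ∀ r ∈ I, iterCovDeriv g baseCurve 2 r = ![-k r ^ 2, deriv k r] := fun r hr => by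
    rw [step 1 (fun _ => 0) k (fun _ => 0) (deriv k) e1 (fun r _ => hasDerivAt_const r 0) d0 r hr]
    congr 1
    · ring
    · simp
  have e3 : ∀ r ∈ I, iterCovDeriv g baseCurve 3 r =
      ![-3 * k r * deriv k r, iteratedDeriv 2 k r - k r ^ 3] := fun r hr => by
    rw [step 2 (fun r => -k r ^ 2) (deriv k) (fun r => -(2 * k r * deriv k r)) (iteratedDeriv 2 k)
      e2 (fun r hr => ((d0 r hr).pow 2).neg.congr_deriv (by simp)) d1 r hr]
    congr 1
    · ring
    · congr 1; ring
  have e4 : ∀ r ∈ I, iterCovDeriv g baseCurve 4 r =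
      ![-3 * deriv k r ^ 2 - 4 * (k r * iteratedDeriv 2 k r) + k r ^ 4,
        iteratedDeriv 3 k r - 6 * (k r ^ 2 * deriv k r)] := fun r hr => by
    rw [step 3 _ _ (fun r => -3 * deriv k r * deriv k r + -3 * k r * iteratedDeriv 2 k r)
      (fun r => iteratedDeriv 3 k r - 3 * k r ^ 2 * deriv k r) e3
      (fun r hr => ((d0 r hr).const_mul (-3)).mul (d1 r hr))
      (fun r hr => ((d2 r hr).sub ((d0 r hr).pow 3)).congr_deriv (by simp)) r hr]
    congr 1
    · ring
    · congr 1; ring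
  refine ⟨e1 s hs, e2 s hs, e3 s hs, ?_⟩
  rw [step 4 _ _ (fun r => -3 * (2 * deriv k r * iteratedDeriv 2 k r)
        - 4 * (deriv k r * iteratedDeriv 2 k r + k r * iteratedDeriv 3 k r)
        + 4 * k r ^ 3 * deriv k r)
      (fun r => iteratedDeriv 4 k r
        - 6 * (2 * k r * deriv k r * deriv k r + k r ^ 2 * iteratedDeriv 2 k r)) e4
      (fun r hr => 
        (((((d1 r hr).pow 2).const_mul (-3)).sub
          (((d0 r hr).mul (d2 r hr)).const_mul 4)).add ((d0 r hr).pow 4)).congr_deriv (by simp))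
      (fun r hr => 
        ((d3 r hr).sub ((((d0 r hr).pow 2).mul (d1 r hr)).const_mul 6)).congr_deriv (by simp)) s hs]
  congr 1
  · ring
  · congr 1; ring

end Equation

end TriharmonicCurves

open TriharmonicCurves in
theorem mainTheorem2 (I : Set ℝ) (hI_open : IsOpen I) (hI_conn : I.OrdConnected)
    (α : ℝ → EuclideanSpace ℝ (Fin 3)) (hα : ContDiffOn ℝ ∞ α I)
    (hα_unit : ∀ s ∈ I, ‖deriv α s‖ = 1)
    (κ τ : ℝ → ℝ) (hκ : κ = TriharmonicCurves.curvature α)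
    (hτ : τ = TriharmonicCurves.torsion α)
    (hκ_ne : ∀ s ∈ I, κ s ≠ 0)
    (hκ_nonconst : ¬ ∃ c : ℝ, ∀ s ∈ I, κ s = c)
    (c₁ c₂ : ℝ)
    (hκ_eq : ∀ s ∈ I, 5 * (deriv κ s) ^ 2 = c₂ - 2 * c₁ * (1 / κ s) + κ s ^ 4)
    (hτ_eq : ∀ s ∈ I,
      iteratedDeriv 4 κ s - 15 * κ s * (deriv κ s) ^ 2 - 10 * κ s ^ 2 * iteratedDeriv 2 κ s
        + κ s ^ 5 - τ s ^ 2 * (iteratedDeriv 2 κ s - 2 * κ s ^ 3) = 0) :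
    TriharmonicCurves.IsRiemannianMetricOn
        (TriharmonicCurves.firstFundamentalForm (TriharmonicCurves.normalRuled α))
        (TriharmonicCurves.regularDomain α I) ∧
      (∀ s ∈ I, TriharmonicCurves.normalRuled α (TriharmonicCurves.baseCurve s) = α s) ∧
      TriharmonicCurves.IsTriharmonicCurve
        (TriharmonicCurves.firstFundamentalForm (TriharmonicCurves.normalRuled α))
        (TriharmonicCurves.regularDomain α I) I TriharmonicCurves.baseCurve ∧
      (∀ s ∈ I, TriharmonicCurves.geodesicCurvature
        (TriharmonicCurves.firstFundamentalForm (TriharmonicCurves.normalRuled α))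
        TriharmonicCurves.baseCurve s = κ s) ∧
      (∀ s ∈ I, TriharmonicCurves.covDerivAlong
        (TriharmonicCurves.firstFundamentalForm (TriharmonicCurves.normalRuled α))
        TriharmonicCurves.baseCurve (TriharmonicCurves.velocity TriharmonicCurves.baseCurve) s
          = κ s • TriharmonicCurves.rotJ
            (TriharmonicCurves.firstFundamentalForm (TriharmonicCurves.normalRuled α))
            (TriharmonicCurves.baseCurve s)
            (TriharmonicCurves.velocity TriharmonicCurves.baseCurve s)) ∧
      ¬ ∃ c : ℝ, ∀ s ∈ I, TriharmonicCurves.geodesicCurvature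
        (TriharmonicCurves.firstFundamentalForm (TriharmonicCurves.normalRuled α))
        TriharmonicCurves.baseCurve s = c := by
  subst hκ hτ
  have hk := contDiffOn_curvature hI_open hα hκ_ne
  have hm := contDiffOn_normalSpeedSq hI_open hα hκ_ne
  have hg := firstFundamentalForm_normalRuled hI_open hα hα_unit hκ_ne
  have hgs : ∀ s ∈ I, firstFundamentalForm (normalRuled α) (baseCurve s) = !![1, 0; 0, 1] :=
    fun s hs => by rw [hg (baseCurve s) hs, lengthCoeff_baseCurve]
  have hcov : ∀ s ∈ I, covDerivAlong (firstFundamentalForm (normalRuled α)) baseCurve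
      (velocity baseCurve) s = ![0, curvature α s] := fun s hs =>
    (iterCovDeriv_baseCurve hI_open hk hm hg hs).1
  have hgeo : ∀ s ∈ I, geodesicCurvature (firstFundamentalForm (normalRuled α)) baseCurve s
      = curvature α s := fun s hs => by
    rw [geodesicCurvature, hcov s hs]
    simp [metricInner, rotJ, hgs s hs, velocity_baseCurve]
  refine ⟨isRiemannianMetricOn_normalRuled hI_open hα hκ_ne, fun s _ => ?_, ⟨fun s hs => ⟨hs, ?_⟩,
    ?_, fun s hs => ?_, fun s hs => ?_⟩, hgeo, fun s hs => ?_, fun ⟨c, hc⟩ => hκ_nonconst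
      ⟨c, fun s hs => (hgeo s hs).symm.trans (hc s hs)⟩⟩
  · simp [normalRuled, baseCurve]
  · rw [← det_firstFundamentalForm_ne_zero_iff, hgs s hs]
    simp
  · refine contDiffOn_pi.2 fun i => ?_
    fin_cases i
    · exact contDiffOn_id
    · exact contDiffOn_const
  · simp [metricInner, hgs s hs, velocity_baseCurve]
  · obtain ⟨e1, e2, e3, e5⟩ := iterCovDeriv_baseCurve hI_open hk hm hg hs
    have h3 := third_order_of_first_order hI_open hk hκ_ne hκ_eq hs
    have hv : velocity baseCurve s = ![1, 0] := congrFun velocity_baseCurve s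
    rw [e1, e2, e3, e5, hv, riemann_baseCurve hI_open hk hm hg hs,
      riemann_baseCurve hI_open hk hm hg hs, h3,
      normalSpeedSq_eq hI_open hα hα_unit hκ_ne hs]
    funext l
    fin_cases l
    · simp
    · simp
      linear_combination hτ_eq s hs
  · rw [hcov s hs]
    funext l
    fin_cases l <;> simp [rotJ, hgs s hs, velocity_baseCurve]
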